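/- Let $c_1,c_2,c_3>0$ and let $\lambda\in\bigl[-\tfrac{\pi}{2}\sum_{j=1}^3c_j,\,-\sum_{j=1}^3c_j\bigr)$. For $x>0$ and $j=1,2,3$ let $$\varphi_j(x)=4\arctan\bigl(e^{-(x-b_j)/c_j}\bigr),$$ where the real constants $b_j$ are those for which $\varphi_1(0)=\varphi_2(0)=\varphi_3(0)$, $c_1\varphi_1'(0)=c_2\varphi_2'(0)=c_3\varphi_3'(0)$ and $\sum_{j=1}^3c_j\varphi_j(0)=\lambda c_1\varphi_1'(0)$. On the complex Hilbert space $L^2(\mathcal Y)=\bigoplus_{j=1}^3L^2(0,\infty)$ consider the operator $$\mathcal W_\lambda\mathbf v=\bigl(-c_j^2v_j''+\cos(\varphi_j)\,v_j\bigr)_{j=1}^3,\qquad \mathbf v=(v_1,v_2,v_3),$$ with domain $$D(\mathcal W_\lambda)=\Bigl\{\mathbf v\in\bigoplus_{j=1}^3H^2(0,\infty):\ c_1v_1'(0+)=c_2v_2'(0+)=c_3v_3'(0+),\ \sum_{j=1}^3c_jv_j(0+)=\lambda c_1v_1'(0+)\Bigr\}.$$ Then the Morse index of $\mathcal W_\lambda$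 is $n(\mathcal W_\lambda)=1$; that is, the number of negative eigenvalues of $\mathcal W_\lambda$, counted with multiplicity (the dimension of the eigenspace), is exactly one. -/

import Mathlib

open MeasureTheory Set Filter Topology
open scoped ContDiff

noncomputable section

namespace Tricrystal

/-- The complex Hilbert space `L²(0, ∞)` of a single edge. -/
abbrev L2 : Type := Lp ℂ 2 ((volume : Measure ℝ).restrict (Ioi 0))

/-- The Hilbert space `L²(𝒴) = L²(0, ∞) ⊕ L²(0, ∞) ⊕ L²(0, ∞)` of the junction. -/
abbrev L2Y : Type := PiLp 2 (fun _ : Fin 3 => L2)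

/-- `g` is the weak (distributional) derivative of `f` on `(0, ∞)`. -/
def HasWeakDeriv (f g : L2) : Prop :=
  ∀ η : ℝ → ℝ, ContDiff ℝ ∞ η → HasCompactSupport η → tsupport η ⊆ Ioi 0 →
    ∫ x in Ioi (0 : ℝ), deriv η x • f x = -∫ x in Ioi (0 : ℝ), η x • g x

lemma integrable_test_smul (η : ℝ → ℝ) (hη : Continuous η) (hc : HasCompactSupport η) (f : L2) :
    Integrable (fun x => η x • f x) ((volume : Measure ℝ).restrict (Ioi 0)) :=
  memLp_one_iff_integrable.mp (MemLp.smul (p := 2) (q := 2) (r := 1) (Lp.memLp f)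
    ((hη.memLp_of_hasCompactSupport hc).restrict _))

lemma HasWeakDeriv.unique {f g h : L2} (hg : HasWeakDeriv f g) (hh : HasWeakDeriv f h) :
    g = h := by
  have hloc : LocallyIntegrableOn (fun x => g x - h x) (Ioi (0 : ℝ)) volume := by
    have h1 : LocallyIntegrable (fun x => (g - h : L2) x)
        ((volume : Measure ℝ).restrict (Ioi 0)) :=
      (Lp.memLp (g - h)).locallyIntegrable (by norm_num)
    refine (locallyIntegrableOn_of_locallyIntegrable_restrict (h1.congr ?_))
    exact Lp.coeFn_sub g h
  have key := isOpen_Ioi.ae_eq_zero_of_integral_contDiff_smul_eq_zero hloc (fun η h1 h2 h3 => by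
    have e : ∫ x in Ioi (0 : ℝ), η x • (g x - h x) = 0 := by
      simp_rw [smul_sub]
      rw [integral_sub (integrable_test_smul η h1.continuous h2 g)
        (integrable_test_smul η h1.continuous h2 h)]
      have a := hg η h1 h2 h3
      have b := hh η h1 h2 h3
      rw [a] at b
      rw [neg_inj.mp b, sub_self]
    rw [← e, setIntegral_eq_integral_of_forall_compl_eq_zero]
    intro x hx
    have : η x = 0 := by
      by_contra h0
      exact hx (h3 (subset_tsupport η h0))
    rw [this, zero_smul])
  apply Lp.ext
  rw [EventuallyEq, ae_restrict_iff' measurableSet_Ioi]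
  filter_upwards [key] with x hx h0
  exact sub_eq_zero.mp (hx h0)

lemma HasWeakDeriv.add {f g f' g' : L2} (h : HasWeakDeriv f g) (h' : HasWeakDeriv f' g') :
    HasWeakDeriv (f + f') (g + g') := by
  intro η h1 h2 h3
  have hd : Continuous (deriv η) := h1.continuous_deriv (by simp)
  have e1 : ∫ x in Ioi (0 : ℝ), deriv η x • (f + f' : L2) x
      = ∫ x in Ioi (0 : ℝ), (deriv η x • f x + deriv η x • f' x) := by
    apply integral_congr_ae
    filter_upwards [Lp.coeFn_add f f'] with x hx
    rw [hx, Pi.add_apply, smul_add]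
  have e2 : ∫ x in Ioi (0 : ℝ), η x • (g + g' : L2) x
      = ∫ x in Ioi (0 : ℝ), (η x • g x + η x • g' x) := by
    apply integral_congr_ae
    filter_upwards [Lp.coeFn_add g g'] with x hx
    rw [hx, Pi.add_apply, smul_add]
  rw [e1, e2, integral_add (integrable_test_smul _ hd h2.deriv f)
      (integrable_test_smul _ hd h2.deriv f'),
    integral_add (integrable_test_smul η h1.continuous h2 g)
      (integrable_test_smul η h1.continuous h2 g'), h η h1 h2 h3, h' η h1 h2 h3, neg_add]

lemma HasWeakDeriv.smul {f g : L2} (a : ℂ) (h : HasWeakDeriv f g) :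
    HasWeakDeriv (a • f) (a • g) := by
  intro η h1 h2 h3
  have e1 : ∫ x in Ioi (0 : ℝ), deriv η x • (a • f : L2) x
      = ∫ x in Ioi (0 : ℝ), a • (deriv η x • f x) := by
    apply integral_congr_ae
    filter_upwards [Lp.coeFn_smul a f] with x hx
    rw [hx, Pi.smul_apply, smul_comm]
  have e2 : ∫ x in Ioi (0 : ℝ), η x • (a • g : L2) x
      = ∫ x in Ioi (0 : ℝ), a • (η x • g x) := by
    apply integral_congr_ae
    filter_upwards [Lp.coeFn_smul a g] with x hx
    rw [hx, Pi.smul_apply, smul_comm]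
  rw [e1, e2, integral_smul, integral_smul, h η h1 h2 h3, smul_neg]

lemma HasWeakDeriv.zero : HasWeakDeriv 0 0 := by
  simpa using HasWeakDeriv.smul (0 : ℂ) (f := 0) (g := 0) (fun η _ _ _ => by
    have e (ζ : ℝ → ℝ) : ∫ x in Ioi (0 : ℝ), ζ x • (0 : L2) x = 0 := by
      rw [integral_eq_zero_of_ae]
      filter_upwards [Lp.coeFn_zero ℂ 2 ((volume : Measure ℝ).restrict (Ioi 0))] with x hx
      rw [hx]; simp
    rw [e, e, neg_zero])

/-- The limit `f(0+)` of (the continuous representative of) `f` at the vertex equals `a`. -/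
def HasTrace (f : L2) (a : ℂ) : Prop :=
  ∃ F : ℝ → ℂ, (f =ᵐ[(volume : Measure ℝ).restrict (Ioi 0)] F) ∧
    ContinuousOn F (Ioi 0) ∧ Tendsto F (𝓝[>] 0) (𝓝 a)

lemma HasTrace.add {f g : L2} {a b : ℂ} (hf : HasTrace f a) (hg : HasTrace g b) :
    HasTrace (f + g) (a + b) := by
  obtain ⟨F, h1, h2, h3⟩ := hf
  obtain ⟨G, k1, k2, k3⟩ := hg
  exact ⟨F + G, (Lp.coeFn_add f g).trans (h1.add k1), h2.add k2, h3.add k3⟩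

lemma HasTrace.smul {f : L2} {a : ℂ} (k : ℂ) (hf : HasTrace f a) : HasTrace (k • f) (k • a) := by
  obtain ⟨F, h1, h2, h3⟩ := hf
  exact ⟨k • F, (Lp.coeFn_smul k f).trans (h1.const_smul k), h2.const_smul k, h3.const_smul k⟩

lemma HasTrace.zero : HasTrace 0 0 :=
  ⟨0, Lp.coeFn_zero _ _ _, continuousOn_const, tendsto_const_nhds⟩

/-- The data of the domain of the `δ'`-interaction: `v ∈ H²(𝒴)` with first and second (weak)
derivatives `v'`, `v''` in `L²(𝒴)`, and
`c₁v₁'(0+) = c₂v₂'(0+) = c₃v₃'(0+)`, `∑ⱼ cⱼvⱼ(0+) = lam c₁v₁'(0+)`. -/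
def DeltaPrime (c : Fin 3 → ℝ) (lam : ℝ) (v v' v'' : L2Y) : Prop :=
  (∀ j, HasWeakDeriv (v j) (v' j)) ∧ (∀ j, HasWeakDeriv (v' j) (v'' j)) ∧
  ∃ p q : Fin 3 → ℂ, (∀ j, HasTrace (v j) (p j)) ∧ (∀ j, HasTrace (v' j) (q j)) ∧
    (c 0 : ℂ) * q 0 = (c 1 : ℂ) * q 1 ∧ (c 1 : ℂ) * q 1 = (c 2 : ℂ) * q 2 ∧
    ∑ j, (c j : ℂ) * p j = (lam : ℂ) * ((c 0 : ℂ) * q 0)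

lemma DeltaPrime.add {c : Fin 3 → ℝ} {lam : ℝ} {v v' v'' w w' w'' : L2Y}
    (hv : DeltaPrime c lam v v' v'') (hw : DeltaPrime c lam w w' w'') :
    DeltaPrime c lam (v + w) (v' + w') (v'' + w'') := by
  obtain ⟨a1, a2, p, q, a3, a4, a5, a6, a7⟩ := hv
  obtain ⟨b1, b2, r, s, b3, b4, b5, b6, b7⟩ := hw
  refine ⟨fun j => (a1 j).add (b1 j), fun j => (a2 j).add (b2 j), p + r, q + s,
    fun j => (a3 j).add (b3 j), fun j => (a4 j).add (b4 j), ?_, ?_, ?_⟩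
  · simp only [Pi.add_apply, mul_add, a5, b5]
  · simp only [Pi.add_apply, mul_add, a6, b6]
  · simp only [Pi.add_apply, mul_add, Finset.sum_add_distrib, a7, b7]

lemma DeltaPrime.smul {c : Fin 3 → ℝ} {lam : ℝ} {v v' v'' : L2Y} (k : ℂ)
    (hv : DeltaPrime c lam v v' v'') : DeltaPrime c lam (k • v) (k • v') (k • v'') := by
  obtain ⟨a1, a2, p, q, a3, a4, a5, a6, a7⟩ := hv
  refine ⟨fun j => (a1 j).smul k, fun j => (a2 j).smul k, k • p, k • q,
    fun j => (a3 j).smul k, fun j => (a4 j).smul k, ?_, ?_, ?_⟩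
  · simp only [Pi.smul_apply, smul_eq_mul]
    linear_combination k * a5
  · simp only [Pi.smul_apply, smul_eq_mul]
    linear_combination k * a6
  · simp only [Pi.smul_apply, smul_eq_mul]
    calc ∑ j, (c j : ℂ) * (k * p j) = k * ∑ j, (c j : ℂ) * p j := by
          rw [Finset.mul_sum]
          exact Finset.sum_congr rfl (fun j _ => by ring)
      _ = _ := by rw [a7]; ring

/-- The domain of the operators with `δ'`-interaction of strength `lam` at the vertex. -/
def deltaPrimeDomain (c : Fin 3 → ℝ) (lam : ℝ) : Submodule ℂ L2Y where
  carrier := {v | ∃ v' v'', DeltaPrime c lam v v' v''}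
  add_mem' := by
    rintro v w ⟨v', v'', hv⟩ ⟨w', w'', hw⟩
    exact ⟨_, _, hv.add hw⟩
  zero_mem' := ⟨0, 0, fun _ => .zero, fun _ => .zero, 0, 0, fun _ => .zero, fun _ => .zero,
    by simp, by simp, by simp⟩
  smul_mem' := by
    rintro k v ⟨v', v'', hv⟩
    exact ⟨_, _, hv.smul k⟩

lemma DeltaPrime.unique {c : Fin 3 → ℝ} {lam : ℝ} {v v' v'' w' w'' : L2Y}
    (h : DeltaPrime c lam v v' v'') (k : DeltaPrime c lam v w' w'') : v'' = w'' := by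
  have e : v' = w' := by
    ext1 j
    exact (h.1 j).unique (k.1 j)
  subst e
  ext1 j
  exact (h.2.1 j).unique (k.2.1 j)

/-- The second (weak) derivative on the domain of the `δ'`-interaction. -/
def secondDeriv (c : Fin 3 → ℝ) (lam : ℝ) : deltaPrimeDomain c lam →ₗ[ℂ] L2Y where
  toFun v := v.2.choose_spec.choose
  map_add' v w := (v + w).2.choose_spec.choose_spec.unique
    (v.2.choose_spec.choose_spec.add w.2.choose_spec.choose_spec)
  map_smul' k v := (k • v).2.choose_spec.choose_spec.unique (v.2.choose_spec.choose_spec.smul k)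

/-- The profile `4 arctan (exp (-(x - b) / c))`. -/
def kinkProfile (c b x : ℝ) : ℝ := 4 * Real.arctan (Real.exp (-(x - b) / c))

/-- The shifts `b` are such that the profiles agree at the vertex and satisfy the
`δ'`-interaction boundary conditions of strength `lam`. -/
structure IsKinkShift (c : Fin 3 → ℝ) (lam : ℝ) (b : Fin 3 → ℝ) : Prop where
  continuous_vertex : ∀ i j, kinkProfile (c i) (b i) 0 = kinkProfile (c j) (b j) 0
  flux : ∀ i j, c i * deriv (kinkProfile (c i) (b i)) 0 = c j * deriv (kinkProfile (c j) (b j)) 0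
  kirchhoff : ∑ j, c j * kinkProfile (c j) (b j) 0 = lam * (c 0 * deriv (kinkProfile (c 0) (b 0)) 0)

lemma continuous_kinkProfile (c b : ℝ) : Continuous (kinkProfile c b) := by
  unfold kinkProfile
  fun_prop

lemma memLp_cos_kink_mul (c b : ℝ) (f : L2) :
    MemLp (fun x => (Real.cos (kinkProfile c b x) : ℂ) * f x) 2
      ((volume : Measure ℝ).restrict (Ioi 0)) := by
  have hc : Continuous fun x => (Real.cos (kinkProfile c b x) : ℂ) :=
    Complex.continuous_ofReal.comp (Real.continuous_cos.comp (continuous_kinkProfile c b))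
  refine (Lp.memLp f).of_le (hc.aestronglyMeasurable.mul (Lp.aestronglyMeasurable f))
    (Eventually.of_forall fun x => ?_)
  rw [norm_mul, Complex.norm_real, Real.norm_eq_abs]
  exact mul_le_of_le_one_left (norm_nonneg _) (Real.abs_cos_le_one _)

/-- Multiplication by `cos φ` on `L²(0, ∞)`, for the profile `φ = kinkProfile c b`. -/
def cosKinkMul (c b : ℝ) : L2 →ₗ[ℂ] L2 where
  toFun f := (memLp_cos_kink_mul c b f).toLp _
  map_add' f g := by
    rw [← MemLp.toLp_add, MemLp.toLp_eq_toLp_iff]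
    filter_upwards [Lp.coeFn_add f g] with x hx
    simp only [hx, Pi.add_apply, mul_add]
  map_smul' k f := by
    rw [RingHom.id_apply, ← MemLp.toLp_const_smul, MemLp.toLp_eq_toLp_iff]
    filter_upwards [Lp.coeFn_smul k f] with x hx
    simp only [hx, Pi.smul_apply, smul_eq_mul]
    ring

/-- The linearized operator `𝒲_lam v = (-cⱼ² vⱼ'' + cos(φⱼ) vⱼ)ⱼ` around the profile
`φⱼ = kinkProfile (c j) (b j)`, with the domain of the `δ'`-interaction of strength `lam`. -/
def linearizedOp (c b : Fin 3 → ℝ) (lam : ℝ) : L2Y →ₗ.[ℂ] L2Y where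
  domain := deltaPrimeDomain c lam
  toFun :=
    { toFun := fun v => WithLp.toLp 2 fun j =>
        -((c j : ℂ) ^ 2 • secondDeriv c lam v j) + cosKinkMul (c j) (b j) ((v : L2Y) j)
      map_add' := fun v w => by
        ext1 j
        simp only [map_add, PiLp.add_apply, Submodule.coe_add, smul_add]
        abel
      map_smul' := fun k v => by
        ext1 j
        simp only [map_smul, PiLp.smul_apply, Submodule.coe_smul, smul_add, RingHom.id_apply,
          smul_neg]
        rw [smul_comm] }

/-- The eigenspace `{v ∈ D(A) : A v = μ v}` of an operator `A` in a complex space. -/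
def eigenspace {H : Type*} [AddCommGroup H] [Module ℂ H] (A : H →ₗ.[ℂ] H) (μ : ℝ) :
    Submodule ℂ A.domain :=
  LinearMap.ker (A.toFun - (μ : ℂ) • A.domain.subtype)

/-- The Morse index `n(A)`: the number of negative eigenvalues of `A`, each counted as often as
the dimension of its eigenspace says. -/
def morseIndex {H : Type*} [AddCommGroup H] [Module ℂ H] (A : H →ₗ.[ℂ] H) : Cardinal :=
  Cardinal.sum fun μ : Iio (0 : ℝ) => Module.rank ℂ (eigenspace A μ)

end Tricrystal

end

noncomputable section

namespace Tricrystal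

/-! With `φ = kinkProfile c b`, the function `T = cos (φ / 2)` satisfies `c T' = 1 - T²`, and the
potential is `cos φ = 2 T² - 1`. This is a reflectionless Pöschl–Teller potential, so for `μ = 1 -
k²` with `k > 1` the edge equation has an explicit positive decaying solution `exp (-k x / c) (k +
T)`. A Wronskian argument shows that every square integrable weak solution is a multiple of it
(`exists_ae_eq_smul_of_weak_solution`).

An eigenvector is therefore given by three coefficients. At the vertex all edges share the same
value `t` of `T`, and equality of the fluxes forces the coefficients to agree, because `k² + k t +
t² - 1 > 0` when `t ≥ 0`. So each negative eigenspace has dimension at most one, and it is nonzero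
exactly when `secular` vanishes at `k` (`exists_eq_smul_decayingVector`,
`decayingVector_mem_eigenspace`).

It remains to count the roots `k > 1` of a quadratic with leading coefficient `lam < 0`. Put `θ =
φ(0) / 2` and `S = ∑ cⱼ`. The profile conditions give `S θ = -lam sin θ`; the lower bound on `lam`
then gives `θ ≤ π / 2`, hence `t = cos θ ≥ 0`. The inequality `θ cos θ < sin θ` makes the quadratic
positive at `1` (`secular_one_pos`), so it has exactly one root beyond `1`. -/

/-! ### Test functions and the lemma of du Bois-Reymond -/

/-- A real test function on `(0, ∞)`. -/
structure IsTest (η : ℝ → ℝ) : Prop where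
  contDiff : ContDiff ℝ ∞ η
  hasCompactSupport : HasCompactSupport η
  tsupport_subset : tsupport η ⊆ Ioi 0

lemma IsTest.mul {η χ : ℝ → ℝ} (hη : IsTest η) (hχ : ContDiff ℝ ∞ χ) :
    IsTest (fun x => η x * χ x) where
  contDiff := hη.contDiff.mul hχ
  hasCompactSupport := hη.hasCompactSupport.mul_right
  tsupport_subset := (tsupport_mul_subset_left (f := η) (g := χ)).trans hη.tsupport_subset

lemma IsTest.deriv {η : ℝ → ℝ} (hη : IsTest η) : IsTest (deriv η) where
  contDiff := (contDiff_infty_iff_deriv.mp hη.contDiff).2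
  hasCompactSupport := hη.hasCompactSupport.deriv
  tsupport_subset := (tsupport_deriv_subset (f := η)).trans hη.tsupport_subset

lemma IsTest.exists_bounds {η : ℝ → ℝ} (hη : IsTest η) :
    ∃ a d, 0 < a ∧ tsupport η ⊆ Icc a d := by
  -- Inserting `1` keeps the compact set nonempty, even for `η = 0`, without leaving `(0, ∞)`.
  have hc : IsCompact (insert 1 (tsupport η)) := hη.hasCompactSupport.isCompact.insert 1
  obtain ⟨a, ha, ha'⟩ := hc.exists_isLeast (insert_nonempty _ _)
  obtain ⟨d, -, hd⟩ := hc.exists_isGreatest (insert_nonempty _ _)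
  refine ⟨a, d, ?_, fun x hx => ⟨ha' (mem_insert_of_mem _ hx), hd (mem_insert_of_mem _ hx)⟩⟩
  rcases ha with rfl | ha
  · exact one_pos
  · exact hη.tsupport_subset ha

/-- A test function of integral zero is the derivative of a test function. -/
lemma IsTest.exists_deriv_eq {ζ : ℝ → ℝ} (hζ : IsTest ζ) (h0 : ∫ x, ζ x = 0) :
    ∃ η, IsTest η ∧ _root_.deriv η = ζ := by
  obtain ⟨a, d, ha, had⟩ := hζ.exists_bounds
  have hz : ∀ x, x ∉ Icc a d → ζ x = 0 := fun x hx =>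
    image_eq_zero_of_notMem_tsupport fun h => hx (had h)
  have hd : ∀ x, HasDerivAt (fun x => ∫ t in (0 : ℝ)..x, ζ t) (ζ x) x := fun x =>
    hζ.contDiff.continuous.integral_hasStrictDerivAt 0 x |>.hasDerivAt
  have hd' : _root_.deriv (fun x => ∫ t in (0 : ℝ)..x, ζ t) = ζ := funext fun x => (hd x).deriv
  -- The primitive vanishes to the left of `a` because `ζ` does, and to the right of `d` because the
  -- total integral is zero.
  have hs : Function.support (fun x => ∫ t in (0 : ℝ)..x, ζ t) ⊆ Icc a d := by
    intro x hx
    by_contra hn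
    apply hx
    rw [mem_Icc, not_and_or, not_le, not_le] at hn
    rcases hn with hn | hn
    · refine intervalIntegral.integral_zero_ae (Eventually.of_forall fun t ht => hz t fun h => ?_)
      rw [mem_uIoc] at ht
      rcases ht with ht | ht
      · linarith [h.1, ht.2]
      · linarith [h.1, ht.2]
    · refine (intervalIntegral.integral_eq_integral_of_support_subset fun t ht => ?_).trans h0
      have : t ∈ Icc a d := by
        by_contra h
        exact ht (hz t h)
      exact ⟨ha.trans_le this.1, this.2.trans hn.le⟩
  have hts := closure_minimal hs isClosed_Icc
  refine ⟨_, ⟨contDiff_infty_iff_deriv.mpr ⟨fun x => (hd x).differentiableAt, ?_⟩,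
    HasCompactSupport.of_support_subset_isCompact isCompact_Icc hs, fun x hx => ?_⟩, hd'⟩
  · rw [hd']; exact hζ.contDiff
  · exact ha.trans_le (hts hx).1

lemma exists_isTest_integral_eq_one : ∃ ρ, IsTest ρ ∧ ∫ x, ρ x = 1 := by
  let B : ContDiffBump (2 : ℝ) := ⟨1 / 2, 1, by norm_num, by norm_num⟩
  refine ⟨B.normed volume, ⟨B.contDiff_normed, B.hasCompactSupport_normed, ?_⟩,
    B.integral_normed⟩
  rw [B.tsupport_normed_eq, Real.closedBall_eq_Icc]
  intro x hx
  have : (2 : ℝ) - 1 ≤ x := hx.1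
  exact mem_Ioi.mpr (by linarith)

lemma IsTest.setIntegral_eq {E : Type*} [NormedAddCommGroup E] [NormedSpace ℝ E]
    {η : ℝ → ℝ} (hη : IsTest η) (f : ℝ → E) :
    ∫ x in Ioi (0 : ℝ), η x • f x = ∫ x, η x • f x := by
  refine setIntegral_eq_integral_of_forall_compl_eq_zero fun x hx => ?_
  rw [image_eq_zero_of_notMem_tsupport fun h => hx (hη.tsupport_subset h), zero_smul]

lemma IsTest.integrable_smul {η : ℝ → ℝ} (hη : IsTest η) {f : ℝ → ℂ}
    (hf : LocallyIntegrableOn f (Ioi 0)) : Integrable (fun x => η x • f x) := by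
  have h1 := hf.integrableOn_compact_subset hη.tsupport_subset hη.hasCompactSupport.isCompact
  have h2 : IntegrableOn (fun x => η x • f x) (tsupport η) :=
    h1.continuousOn_smul hη.contDiff.continuous.continuousOn hη.hasCompactSupport.isCompact
  rwa [integrableOn_iff_integrable_of_support_subset] at h2
  exact (Function.support_smul_subset_left η f).trans (subset_tsupport η)

/-- The lemma of du Bois-Reymond on `(0, ∞)`. -/
lemma exists_ae_eq_const_of_integral_deriv_smul_eq_zero {f : ℝ → ℂ}
    (hf : LocallyIntegrableOn f (Ioi 0))
    (h : ∀ η, IsTest η → ∫ x in Ioi (0 : ℝ), deriv η x • f x = 0) :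
    ∃ C : ℂ, f =ᵐ[(volume : Measure ℝ).restrict (Ioi 0)] fun _ => C := by
  obtain ⟨ρ, hρ, hρ1⟩ := exists_isTest_integral_eq_one
  refine ⟨∫ x, ρ x • f x, ?_⟩
  set C := ∫ x, ρ x • f x
  have hloc : LocallyIntegrableOn (fun x => f x - C) (Ioi (0 : ℝ)) volume :=
    hf.sub (locallyIntegrableOn_const C)
  have key := isOpen_Ioi.ae_eq_zero_of_integral_contDiff_smul_eq_zero hloc fun ζ h1 h2 h3 => by
    have hζ : IsTest ζ := ⟨h1, h2, h3⟩
    have i1 : Integrable ζ := h1.continuous.integrable_of_hasCompactSupport h2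
    have i2 : Integrable ρ := hρ.contDiff.continuous.integrable_of_hasCompactSupport
      hρ.hasCompactSupport
    set I := ∫ x, ζ x
    -- Subtracting `I * ρ` makes the integral zero, so the difference is a derivative that the
    -- hypothesis can be tested on.
    have ht : IsTest (fun x => ζ x - I * ρ x) := by
      have hρI : IsTest (fun x => ρ x * I) := hρ.mul contDiff_const
      refine ⟨h1.sub (contDiff_const.mul hρ.contDiff),
        h2.sub (by simpa only [mul_comm] using hρI.hasCompactSupport), ?_⟩
      refine (tsupport_sub ζ (fun x => I * ρ x)).trans (union_subset h3 ?_)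
      simpa only [mul_comm] using hρI.tsupport_subset
    obtain ⟨η, hη, hd⟩ := ht.exists_deriv_eq (by
      rw [integral_sub i1 (i2.const_mul I), integral_const_mul, hρ1, mul_one, sub_self])
    have e := h η hη
    rw [hη.deriv.setIntegral_eq, hd] at e
    simp_rw [sub_smul, mul_smul] at e
    rw [integral_sub (hζ.integrable_smul hf) ((hρ.integrable_smul hf).fun_smul I),
      integral_smul, sub_eq_zero] at e
    simp_rw [smul_sub]
    rw [integral_sub (hζ.integrable_smul hf) (i1.smul_const C), e, integral_smul_const, sub_self]
  rw [EventuallyEq, ae_restrict_iff' measurableSet_Ioi]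
  filter_upwards [key] with x hx h0
  exact sub_eq_zero.mp (hx h0)

lemma locallyIntegrableOn_coeFn (f : L2) : LocallyIntegrableOn f (Ioi (0 : ℝ)) :=
  locallyIntegrableOn_of_locallyIntegrable_restrict
    ((Lp.memLp f).locallyIntegrable (by norm_num))

lemma IsTest.integrable_smul_coeFn {η : ℝ → ℝ} (hη : IsTest η) (f : L2) :
    Integrable (fun x => η x • f x) ((volume : Measure ℝ).restrict (Ioi 0)) :=
  integrable_test_smul η hη.contDiff.continuous hη.hasCompactSupport f

/-! ### Uniqueness of square integrable weak solutions -/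

/-- The product rule for a weak derivative and a smooth factor. -/
lemma HasWeakDeriv.integral_deriv_mul_smul {f g : L2} (h : HasWeakDeriv f g) {η χ : ℝ → ℝ}
    (hη : IsTest η) (hχ : ContDiff ℝ ∞ χ) :
    ∫ x in Ioi (0 : ℝ), (deriv η x * χ x) • f x =
      -(∫ x in Ioi (0 : ℝ), (η x * deriv χ x) • f x) -
        ∫ x in Ioi (0 : ℝ), (η x * χ x) • g x := by
  have hp := hη.mul hχ
  have e := h _ hp.contDiff hp.hasCompactSupport hp.tsupport_subset
  have hd : ∀ x, deriv (fun x => η x * χ x) x = deriv η x * χ x + η x * deriv χ x := fun x =>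
    deriv_fun_mul (hη.contDiff.differentiable (by simp) x) (hχ.differentiable (by simp) x)
  simp_rw [hd, add_smul] at e
  rw [integral_add ((hη.deriv.mul hχ).integrable_smul_coeFn f)
    ((hη.mul (contDiff_infty_iff_deriv.mp hχ).2).integrable_smul_coeFn f)] at e
  linear_combination e

/-- A square integrable weak solution of `f'' = q f` is a multiple of any positive classical
solution that is square integrable together with its derivative. -/
lemma exists_ae_eq_smul_of_weak_solution {f g h : L2} (hfg : HasWeakDeriv f g)
    (hgh : HasWeakDeriv g h) {ψ q : ℝ → ℝ} (hψ : ContDiff ℝ ∞ ψ) (hpos : ∀ x, 0 < ψ x)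
    (hode : ∀ x, deriv (deriv ψ) x = q x * ψ x)
    (hq : h =ᵐ[(volume : Measure ℝ).restrict (Ioi 0)] fun x => q x • f x)
    (hL : MemLp ψ 2 ((volume : Measure ℝ).restrict (Ioi 0)))
    (hL' : MemLp (deriv ψ) 2 ((volume : Measure ℝ).restrict (Ioi 0))) :
    ∃ a : ℂ, (f =ᵐ[(volume : Measure ℝ).restrict (Ioi 0)] fun x => a * ((ψ x : ℝ) : ℂ)) ∧
      g =ᵐ[(volume : Measure ℝ).restrict (Ioi 0)] fun x => a * ((deriv ψ x : ℝ) : ℂ) := by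
  have hψ' : ContDiff ℝ ∞ (deriv ψ) := (contDiff_infty_iff_deriv.mp hψ).2
  have i1 : Integrable (fun x => deriv ψ x • f x) ((volume : Measure ℝ).restrict (Ioi 0)) :=
    memLp_one_iff_integrable.mp (MemLp.smul (p := 2) (q := 2) (r := 1) (Lp.memLp f) hL')
  have i2 : Integrable (fun x => ψ x • g x) ((volume : Measure ℝ).restrict (Ioi 0)) :=
    memLp_one_iff_integrable.mp (MemLp.smul (p := 2) (q := 2) (r := 1) (Lp.memLp g) hL)
  have hW := i1.sub i2
  -- The Wronskian `ψ' f - ψ g` has weak derivative zero, since `f` and `ψ` solve the same equation.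
  obtain ⟨C, hC⟩ := exists_ae_eq_const_of_integral_deriv_smul_eq_zero
    (f := fun x => deriv ψ x • f x - ψ x • g x)
    (locallyIntegrableOn_of_locallyIntegrable_restrict hW.locallyIntegrable) fun η hη => by
      have e1 := hfg.integral_deriv_mul_smul hη hψ'
      have e2 := hgh.integral_deriv_mul_smul hη hψ
      have e3 : ∫ x in Ioi (0 : ℝ), (η x * deriv (deriv ψ) x) • f x =
          ∫ x in Ioi (0 : ℝ), (η x * ψ x) • h x := by
        refine integral_congr_ae ?_
        filter_upwards [hq] with x hx
        rw [hx, hode, smul_smul]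
        congr 1
        ring
      simp_rw [smul_sub, smul_smul]
      rw [integral_sub ((hη.deriv.mul hψ').integrable_smul_coeFn f)
        ((hη.deriv.mul hψ).integrable_smul_coeFn g)]
      linear_combination e1 - e2 - e3
  -- By Hölder the Wronskian is integrable, and on a half-line of infinite measure the only
  -- integrable constant is zero.
  have hC0 : C = 0 := by
    have h1 : Integrable (fun _ : ℝ => C) ((volume : Measure ℝ).restrict (Ioi 0)) := hW.congr hC
    rcases integrable_const_iff.mp h1 with h2 | h2
    · exact h2
    · exact absurd (isFiniteMeasure_restrict.mp h2) (by simp)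
  have hw : ∀ᵐ x ∂((volume : Measure ℝ).restrict (Ioi 0)), ψ x • g x = deriv ψ x • f x := by
    filter_upwards [hC] with x hx
    rw [hC0] at hx
    exact (sub_eq_zero.mp hx).symm
  have hinv : ContDiff ℝ ∞ (fun x => (ψ x)⁻¹) := hψ.inv fun x => (hpos x).ne'
  -- With zero Wronskian the quotient `f / ψ` has weak derivative zero; positivity of `ψ` makes `1 /
  -- ψ` a smooth factor.
  obtain ⟨a, ha⟩ := exists_ae_eq_const_of_integral_deriv_smul_eq_zero
    (f := fun x => (ψ x)⁻¹ • f x)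
    ((locallyIntegrableOn_coeFn f).continuousOn_smul isOpen_Ioi.isLocallyClosed
      hinv.continuous.continuousOn) fun η hη => by
      have e1 := hfg.integral_deriv_mul_smul hη hinv
      have hd : ∀ x, deriv (fun x => (ψ x)⁻¹) x = -deriv ψ x / ψ x ^ 2 := fun x =>
        deriv_fun_inv'' (hψ.differentiable (by simp) x) (hpos x).ne'
      have e3 : ∫ x in Ioi (0 : ℝ), (η x * (ψ x)⁻¹) • g x =
          -∫ x in Ioi (0 : ℝ), (η x * deriv (fun x => (ψ x)⁻¹) x) • f x := by
        rw [← integral_neg]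
        refine integral_congr_ae ?_
        filter_upwards [hw] with x hx
        have h0 := (hpos x).ne'
        have : g x = (ψ x)⁻¹ • deriv ψ x • f x := by rw [← hx, inv_smul_smul₀ h0]
        rw [this, hd, smul_smul, smul_smul, ← neg_smul]
        congr 1
        field_simp
      simp_rw [smul_smul]
      linear_combination e1 - e3
  have hfa : f =ᵐ[(volume : Measure ℝ).restrict (Ioi 0)] fun x => a * (ψ x : ℂ) := by
    filter_upwards [ha] with x hx
    rw [← hx, mul_comm, ← Complex.real_smul, smul_inv_smul₀ (hpos x).ne']
  refine ⟨a, hfa, ?_⟩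
  filter_upwards [hfa, hw] with x hx hx'
  have h0 : (ψ x : ℂ) ≠ 0 := Complex.ofReal_ne_zero.mpr (hpos x).ne'
  rw [hx, Complex.real_smul, Complex.real_smul] at hx'
  apply mul_left_cancel₀ h0
  linear_combination hx'

/-! ### The kink and the explicit decaying solution -/

/-- The first-order equation of the sine-Gordon kink: with `w = tan (φ / 4)`, the double-angle
formula gives `sin (φ / 2) = 2 w / (1 + w²)`. -/
lemma hasDerivAt_kinkProfile (c b x : ℝ) :
    HasDerivAt (kinkProfile c b) (-(2 / c) * Real.sin (kinkProfile c b x / 2)) x := by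
  have h1 : HasDerivAt (fun x : ℝ => -(x - b) / c) (-1 / c) x :=
    ((hasDerivAt_id x).sub_const b).neg.div_const c
  have h2 := (h1.exp.arctan).const_mul 4
  refine h2.congr_deriv ?_
  set w := Real.exp (-(x - b) / c) with hw
  have e : kinkProfile c b x / 2 = 2 * Real.arctan w := by
    rw [kinkProfile, ← hw]; ring
  have hpos : 0 < 1 + w ^ 2 := by positivity
  have hs : Real.sin (Real.arctan w) * Real.cos (Real.arctan w) = w / (1 + w ^ 2) := by
    rw [Real.sin_arctan, Real.cos_arctan, div_mul_div_comm, Real.mul_self_sqrt hpos.le, mul_one]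
  rw [e, Real.sin_two_mul, mul_assoc 2, hs]
  ring

lemma contDiff_kinkProfile (c b : ℝ) : ContDiff ℝ ∞ (kinkProfile c b) := by
  have h : ContDiff ℝ ∞ fun x : ℝ => Real.exp (-(x - b) / c) := by fun_prop
  exact contDiff_const.mul h.arctan

lemma kinkProfile_pos (c b x : ℝ) : 0 < kinkProfile c b x :=
  mul_pos four_pos (Real.arctan_pos.mpr (Real.exp_pos _))

lemma kinkProfile_lt (c b x : ℝ) : kinkProfile c b x < 2 * Real.pi := by
  have := Real.arctan_lt_pi_div_two (Real.exp (-(x - b) / c))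
  unfold kinkProfile
  linarith

/-- The solution of `-c² v'' + cos φ v = (1 - k²) v`, `φ = kinkProfile c b`, that decays at
infinity. -/
def decayingState (k c b x : ℝ) : ℝ :=
  Real.exp (-(k / c) * x) * (k + Real.cos (kinkProfile c b x / 2))

lemma contDiff_decayingState (k c b : ℝ) : ContDiff ℝ ∞ (decayingState k c b) := by
  have := contDiff_kinkProfile c b
  unfold decayingState
  fun_prop

lemma decayingState_pos {k : ℝ} (hk : 1 < k) (c b x : ℝ) : 0 < decayingState k c b x :=
  mul_pos (Real.exp_pos _) (by linarith [Real.neg_one_le_cos (kinkProfile c b x / 2)])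

lemma hasDerivAt_exp_neg_mul (a x : ℝ) :
    HasDerivAt (fun x => Real.exp (-a * x)) (Real.exp (-a * x) * -a) x := by
  simpa using ((hasDerivAt_id x).const_mul (-a)).exp

/-- The Riccati equation of `tanh ((x - b) / c)`. It makes all derivatives of `decayingState` an
exponential times a polynomial in `cos (φ / 2)`. -/
lemma hasDerivAt_cos_half_kinkProfile (c b x : ℝ) :
    HasDerivAt (fun x => Real.cos (kinkProfile c b x / 2))
      ((1 - Real.cos (kinkProfile c b x / 2) ^ 2) / c) x := by
  refine ((hasDerivAt_kinkProfile c b x).div_const 2).cos.congr_deriv ?_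
  rw [← Real.sin_sq]
  ring

lemma deriv_decayingState (k c b : ℝ) :
    deriv (decayingState k c b) = fun x => Real.exp (-(k / c) * x) *
      (-(k ^ 2 + k * Real.cos (kinkProfile c b x / 2)
        + Real.cos (kinkProfile c b x / 2) ^ 2 - 1) / c) := by
  funext x
  refine (((hasDerivAt_exp_neg_mul (k / c) x).mul
    ((hasDerivAt_cos_half_kinkProfile c b x).const_add k)).congr_deriv ?_).deriv
  ring

lemma deriv_deriv_decayingState (k c b x : ℝ) :
    deriv (deriv (decayingState k c b)) x =
      (Real.cos (kinkProfile c b x) - (1 - k ^ 2)) / c ^ 2 * decayingState k c b x := by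
  have hT := hasDerivAt_cos_half_kinkProfile c b x
  have h := (hasDerivAt_exp_neg_mul (k / c) x).mul
    (((((hT.const_mul k).const_add (k ^ 2)).add (hT.pow 2)).sub_const 1).neg.div_const c)
  have e : deriv (decayingState k c b) = _ := deriv_decayingState k c b
  rw [e]
  refine (h.congr_deriv ?_).deriv
  have hcos : Real.cos (kinkProfile c b x) = 2 * Real.cos (kinkProfile c b x / 2) ^ 2 - 1 := by
    rw [← Real.cos_two_mul]; congr 1; ring
  rw [hcos, decayingState]
  simp only [Pi.add_apply, Pi.neg_apply, Pi.pow_apply]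
  ring

lemma memLp_exp_mul {k M : ℝ} (hk : 0 < k) {g : ℝ → ℝ} (hg : Continuous g)
    (hM : ∀ x, |g x| ≤ M) :
    MemLp (fun x => Real.exp (-k * x) * g x) 2 ((volume : Measure ℝ).restrict (Ioi 0)) := by
  have he : Continuous fun x => Real.exp (-k * x) := by fun_prop
  have h1 : MemLp (fun x => Real.exp (-k * x)) 2 ((volume : Measure ℝ).restrict (Ioi 0)) := by
    rw [memLp_two_iff_integrable_sq he.aestronglyMeasurable]
    refine (integrableOn_exp_mul_Ioi (a := -(2 * k)) (by linarith) 0).congr_fun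
      (fun x _ => ?_) measurableSet_Ioi
    rw [← Real.exp_nat_mul]
    push_cast
    ring_nf
  refine h1.of_le_mul (c := M) (he.mul hg).aestronglyMeasurable (Eventually.of_forall fun x => ?_)
  rw [norm_mul, mul_comm]
  exact mul_le_mul_of_nonneg_right (hM x) (norm_nonneg _)

lemma memLp_decayingState {k c : ℝ} (hk : 0 < k) (hc : 0 < c) (b : ℝ) :
    MemLp (decayingState k c b) 2 ((volume : Measure ℝ).restrict (Ioi 0)) := by
  have := continuous_kinkProfile c b
  refine memLp_exp_mul (div_pos hk hc) (M := k + 1) (by fun_prop) fun x => ?_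
  refine (abs_add_le _ _).trans (add_le_add (abs_of_pos hk).le (Real.abs_cos_le_one _))

lemma memLp_deriv_decayingState {k c : ℝ} (hk : 0 < k) (hc : 0 < c) (b : ℝ) :
    MemLp (deriv (decayingState k c b)) 2 ((volume : Measure ℝ).restrict (Ioi 0)) := by
  have := continuous_kinkProfile c b
  rw [deriv_decayingState]
  refine memLp_exp_mul (div_pos hk hc) (M := (k ^ 2 + k + 2) / c) (by fun_prop) fun x => ?_
  rw [abs_div, abs_of_pos hc]
  gcongr
  have h1 := Real.neg_one_le_cos (kinkProfile c b x / 2)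
  have h2 := Real.cos_le_one (kinkProfile c b x / 2)
  rw [abs_le]
  constructor <;> nlinarith

lemma memLp_deriv_deriv_decayingState {k c : ℝ} (hk : 0 < k) (hc : 0 < c) (b : ℝ) :
    MemLp (deriv (deriv (decayingState k c b))) 2 ((volume : Measure ℝ).restrict (Ioi 0)) := by
  have hd : ContDiff ℝ ∞ (deriv (deriv (decayingState k c b))) :=
    (contDiff_infty_iff_deriv.mp (contDiff_infty_iff_deriv.mp (contDiff_decayingState k c b)).2).2
  refine (memLp_decayingState hk hc b).of_le_mul (c := (2 + k ^ 2) / c ^ 2)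
    hd.continuous.aestronglyMeasurable (Eventually.of_forall fun x => ?_)
  rw [deriv_deriv_decayingState, norm_mul, norm_div, Real.norm_eq_abs, Real.norm_eq_abs,
    abs_of_pos (pow_pos hc 2)]
  gcongr
  have h1 := Real.neg_one_le_cos (kinkProfile c b x)
  have h2 := Real.cos_le_one (kinkProfile c b x)
  rw [abs_le]
  constructor <;> nlinarith

/-! ### Classical functions as elements of the domain -/

/-- The element of `L²(0, ∞)` given by a real-valued square integrable function. -/
def toL2 (ψ : ℝ → ℝ) (h : MemLp ψ 2 ((volume : Measure ℝ).restrict (Ioi 0))) : L2 :=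
  MemLp.toLp (fun x => (ψ x : ℂ)) h.ofReal

lemma coeFn_toL2 (ψ : ℝ → ℝ) (h : MemLp ψ 2 ((volume : Measure ℝ).restrict (Ioi 0))) :
    toL2 ψ h =ᵐ[(volume : Measure ℝ).restrict (Ioi 0)] fun x => (ψ x : ℂ) :=
  MemLp.coeFn_toLp _

lemma hasWeakDeriv_toL2 {ψ : ℝ → ℝ} (hψ : ContDiff ℝ ∞ ψ)
    (h : MemLp ψ 2 ((volume : Measure ℝ).restrict (Ioi 0)))
    (h' : MemLp (deriv ψ) 2 ((volume : Measure ℝ).restrict (Ioi 0))) :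
    HasWeakDeriv (toL2 ψ h) (toL2 (deriv ψ) h') := by
  intro η h1 h2 h3
  have hη : IsTest η := ⟨h1, h2, h3⟩
  have e1 : ∫ x in Ioi (0 : ℝ), deriv η x • toL2 ψ h x = ((∫ x, deriv η x * ψ x : ℝ) : ℂ) := by
    rw [← integral_complex_ofReal]
    simp_rw [Complex.ofReal_mul, ← Complex.real_smul]
    rw [← hη.deriv.setIntegral_eq]
    refine integral_congr_ae ?_
    filter_upwards [coeFn_toL2 ψ h] with x hx
    rw [hx]
  have e2 : ∫ x in Ioi (0 : ℝ), η x • toL2 (deriv ψ) h' x =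
      ((∫ x, η x * deriv ψ x : ℝ) : ℂ) := by
    rw [← integral_complex_ofReal]
    simp_rw [Complex.ofReal_mul, ← Complex.real_smul]
    rw [← hη.setIntegral_eq]
    refine integral_congr_ae ?_
    filter_upwards [coeFn_toL2 (deriv ψ) h'] with x hx
    rw [hx]
  have hint : ∀ {ζ χ : ℝ → ℝ}, IsTest ζ → Continuous χ → Integrable (fun x => ζ x * χ x) :=
    fun hζ hχ => (hζ.contDiff.continuous.mul hχ).integrable_of_hasCompactSupport
      hζ.hasCompactSupport.mul_right
  have hψ' : ContDiff ℝ ∞ (deriv ψ) := (contDiff_infty_iff_deriv.mp hψ).2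
  rw [e1, e2, ← Complex.ofReal_neg]
  congr 1
  rw [integral_mul_deriv_eq_deriv_mul_of_integrable (u := η) (v := ψ) (u' := deriv η)
    (v' := deriv ψ) (fun x _ => (h1.differentiable (by simp) x).hasDerivAt)
    (fun x _ => (hψ.differentiable (by simp) x).hasDerivAt)
    (hint hη hψ'.continuous) (hint hη.deriv hψ.continuous) (hint hη hψ.continuous), neg_neg]

lemma hasTrace_toL2 {ψ : ℝ → ℝ} (hψ : Continuous ψ)
    (h : MemLp ψ 2 ((volume : Measure ℝ).restrict (Ioi 0))) : HasTrace (toL2 ψ h) (ψ 0) :=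
  have hc : Continuous fun x => (ψ x : ℂ) := Complex.continuous_ofReal.comp hψ
  ⟨_, coeFn_toL2 ψ h, hc.continuousOn, hc.continuousAt.tendsto.mono_left nhdsWithin_le_nhds⟩

/-- Continuous representatives that agree almost everywhere on an open set agree everywhere on it,
so the trace does not depend on the representative. -/
lemma HasTrace.eq_of_ae_eq {f : L2} {p : ℂ} (hf : HasTrace f p) {F : ℝ → ℂ} (hF : Continuous F)
    (h : f =ᵐ[(volume : Measure ℝ).restrict (Ioi 0)] F) : p = F 0 := by
  obtain ⟨G, h1, h2, h3⟩ := hf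
  have e : EqOn G F (Ioi 0) :=
    Measure.eqOn_open_of_ae_eq (h1.symm.trans h) isOpen_Ioi h2 hF.continuousOn
  exact tendsto_nhds_unique
    (h3.congr' (eventually_nhdsWithin_of_forall e))
    (hF.continuousAt.tendsto.mono_left nhdsWithin_le_nhds)

lemma decayingState_zero (k c b : ℝ) :
    decayingState k c b 0 = k + Real.cos (kinkProfile c b 0 / 2) := by
  simp [decayingState]

lemma mul_deriv_decayingState_zero (k : ℝ) {c : ℝ} (hc : c ≠ 0) (b : ℝ) :
    c * deriv (decayingState k c b) 0 = -(k ^ 2 + k * Real.cos (kinkProfile c b 0 / 2)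
      + Real.cos (kinkProfile c b 0 / 2) ^ 2 - 1) := by
  rw [deriv_decayingState]
  simp only [mul_zero, Real.exp_zero, one_mul]
  field_simp

/-! ### The vertex angle and the secular equation -/

/-- At the vertex, `θ = φ(0)/2` satisfies `(∑ cⱼ) θ = -lam sin θ`. -/
lemma IsKinkShift.vertex {c b : Fin 3 → ℝ} {lam : ℝ} (hc : ∀ j, 0 < c j)
    (hb : IsKinkShift c lam b) :
    (∑ j, c j) * (kinkProfile (c 0) (b 0) 0 / 2) =
      -lam * Real.sin (kinkProfile (c 0) (b 0) 0 / 2) := by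
  have h := hb.kirchhoff
  rw [(hasDerivAt_kinkProfile _ _ _).deriv,
    Finset.sum_congr rfl fun j _ => by rw [hb.continuous_vertex j 0], ← Finset.sum_mul] at h
  have h0 := (hc 0).ne'
  have e : c 0 * (-(2 / c 0) * Real.sin (kinkProfile (c 0) (b 0) 0 / 2)) =
      -2 * Real.sin (kinkProfile (c 0) (b 0) 0 / 2) := by
    field_simp
  rw [e] at h
  linarith

/-- In `S θ = -lam sin θ`, bound `-lam` by `(π / 2) S` and `sin θ` by `1`. This yields `cos θ ≥ 0`
later. -/
lemma half_kinkProfile_zero_le {c b : Fin 3 → ℝ} {lam : ℝ} (hc : ∀ j, 0 < c j)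
    (hlam : -(Real.pi / 2) * ∑ j, c j ≤ lam) (hb : IsKinkShift c lam b) :
    kinkProfile (c 0) (b 0) 0 / 2 ≤ Real.pi / 2 := by
  have hS : 0 < ∑ j, c j := Finset.sum_pos (fun j _ => hc j) Finset.univ_nonempty
  have hv := hb.vertex hc
  have hpos := kinkProfile_pos (c 0) (b 0) 0
  have hlt := kinkProfile_lt (c 0) (b 0) 0
  have hsin : 0 < Real.sin (kinkProfile (c 0) (b 0) 0 / 2) :=
    Real.sin_pos_of_pos_of_lt_pi (by linarith) (by linarith)
  have hle := Real.sin_le_one (kinkProfile (c 0) (b 0) 0 / 2)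
  refine le_of_mul_le_mul_left ?_ hS
  rw [hv]
  have h1 := mul_le_mul_of_nonneg_right (show -lam ≤ Real.pi / 2 * ∑ j, c j by linarith) hsin.le
  have h2 := mul_le_mul_of_nonneg_left hle (mul_pos (half_pos Real.pi_pos) hS).le
  linarith

/-- The secular function: its zeros `k > 1` are the eigenvalues `1 - k²`. -/
def secular (S t lam k : ℝ) : ℝ := S * (k + t) + lam * (k ^ 2 + k * t + t ^ 2 - 1)

/-- Eliminating `lam` through the vertex relation factors `secular 1 * sin θ` as `S (1 + cos θ) (sin
θ - θ cos θ)`, and the last factor is positive because `θ < tan θ`. -/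
lemma secular_one_pos {S θ lam : ℝ} (hS : 0 < S) (hθ : 0 < θ) (hθ' : θ ≤ Real.pi / 2)
    (h : S * θ = -lam * Real.sin θ) : 0 < secular S (Real.cos θ) lam 1 := by
  have hpi := Real.pi_pos
  have hsin : 0 < Real.sin θ := Real.sin_pos_of_pos_of_lt_pi hθ (by linarith)
  have ht : 0 ≤ Real.cos θ := Real.cos_nonneg_of_mem_Icc ⟨by linarith, hθ'⟩
  have hlt : θ * Real.cos θ < Real.sin θ := by
    -- At `θ = π / 2` the tangent is not available, but there the claim reads `0 < 1`.
    rcases hθ'.lt_or_eq with h1 | rfl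
    · have hcos : 0 < Real.cos θ := Real.cos_pos_of_mem_Ioo ⟨by linarith, h1⟩
      have := Real.lt_tan hθ h1
      rwa [Real.tan_eq_sin_div_cos, lt_div_iff₀ hcos] at this
    · simp
  refine pos_of_mul_pos_left (b := Real.sin θ) ?_ hsin.le
  have e : secular S (Real.cos θ) lam 1 * Real.sin θ =
      S * (1 + Real.cos θ) * (Real.sin θ - θ * Real.cos θ) := by
    unfold secular
    linear_combination (Real.cos θ * (1 + Real.cos θ)) * h
  rw [e]
  exact mul_pos (mul_pos hS (by linarith)) (sub_pos.mpr hlt)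

/-- If the quadratic had two distinct roots `k, l > 1`, its value at `1` would be `lam (k - 1) (l -
1) < 0`. -/
lemma secular_root_unique {S t lam k l : ℝ} (hlam : lam < 0) (h1 : 0 < secular S t lam 1)
    (hk : 1 < k) (hl : 1 < l) (hk0 : secular S t lam k = 0) (hl0 : secular S t lam l = 0) :
    k = l := by
  by_contra hne
  have e : (k - l) * secular S t lam 1 = (k - l) * (lam * (k - 1) * (l - 1)) := by
    unfold secular at *
    linear_combination (1 - l) * hk0 - (1 - k) * hl0
  have e' := mul_left_cancel₀ (sub_ne_zero.mpr hne) e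
  have := mul_pos (sub_pos.mpr hk) (sub_pos.mpr hl)
  nlinarith

lemma exists_secular_root {S t lam : ℝ} (hlam : lam < 0) (h1 : 0 < secular S t lam 1) :
    ∃ k, 1 < k ∧ secular S t lam k = 0 := by
  have hb : Tendsto (fun k => k * (lam * k + (S + lam * t)) + (S * t + lam * (t ^ 2 - 1)))
      atTop atBot :=
    tendsto_atBot_add_const_right _ _ (tendsto_id.atTop_mul_atBot₀
      (tendsto_atBot_add_const_right _ _ (tendsto_id.const_mul_atTop_of_neg hlam)))
  obtain ⟨K, hK, hK1⟩ := ((hb.eventually_lt_atBot 0).and (eventually_gt_atTop 1)).exists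
  have hKn : secular S t lam K < 0 := by
    unfold secular
    linarith
  have hcont : ContinuousOn (secular S t lam) (Icc 1 K) := by
    unfold secular
    fun_prop
  obtain ⟨k, hk, hk0⟩ := intermediate_value_Ioo' hK1.le hcont ⟨hKn, h1⟩
  exact ⟨k, hk.1, hk0⟩

/-! ### Eigenspaces for negative eigenvalues -/

/-- Weak derivatives are unique, so the chosen `secondDeriv` may be replaced by any witness; the
operator equation becomes an edgewise differential equation. -/
lemma mem_eigenspace_linearizedOp_iff {c b : Fin 3 → ℝ} {lam μ : ℝ} (hc : ∀ j, 0 < c j)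
    (v : (linearizedOp c b lam).domain) {v' v'' : L2Y}
    (hv : DeltaPrime c lam v v' v'') :
    v ∈ eigenspace (linearizedOp c b lam) μ ↔
      ∀ j, v'' j =ᵐ[(volume : Measure ℝ).restrict (Ioi 0)] fun x =>
        ((Real.cos (kinkProfile (c j) (b j) x) - μ) / c j ^ 2) • (v : L2Y) j x := by
  have hs : secondDeriv c lam v = v'' := DeltaPrime.unique v.2.choose_spec.choose_spec hv
  have h1 : v ∈ eigenspace (linearizedOp c b lam) μ ↔
      ∀ j, -((c j : ℂ) ^ 2 • v'' j) + cosKinkMul (c j) (b j) ((v : L2Y) j) =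
        (μ : ℂ) • (v : L2Y) j := by
    rw [eigenspace, LinearMap.mem_ker, LinearMap.sub_apply, sub_eq_zero, ← hs]
    exact ⟨fun h j => congrArg (fun w : L2Y => w j) h, fun h => PiLp.ext h⟩
  rw [h1]
  refine forall_congr' fun j => ?_
  have hc0 : (c j : ℂ) ≠ 0 := Complex.ofReal_ne_zero.mpr (hc j).ne'
  rw [Lp.ext_iff]
  have a1 := Lp.coeFn_add (-((c j : ℂ) ^ 2 • v'' j)) (cosKinkMul (c j) (b j) ((v : L2Y) j))
  have a2 := Lp.coeFn_neg ((c j : ℂ) ^ 2 • v'' j)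
  have a3 := Lp.coeFn_smul ((c j : ℂ) ^ 2) (v'' j)
  have a4 := Lp.coeFn_smul (μ : ℂ) ((v : L2Y) j)
  have a5 : cosKinkMul (c j) (b j) ((v : L2Y) j) =ᵐ[(volume : Measure ℝ).restrict (Ioi 0)] _ :=
    MemLp.coeFn_toLp (memLp_cos_kink_mul (c j) (b j) ((v : L2Y) j))
  refine Filter.eventually_congr ?_
  filter_upwards [a1, a2, a3, a4, a5] with x h1 h2 h3 h4 h5
  rw [h1, Pi.add_apply, h2, Pi.neg_apply, h3, h4, h5, Pi.smul_apply, Pi.smul_apply, smul_eq_mul,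
    smul_eq_mul, Complex.real_smul]
  push_cast
  constructor
  · intro h
    field_simp
    linear_combination -h
  · intro h
    rw [h]
    field_simp
    ring

/-- The vector of decaying states on the three edges. -/
def decayingVector {k : ℝ} (hk : 0 < k) {c : Fin 3 → ℝ} (hc : ∀ j, 0 < c j) (b : Fin 3 → ℝ) :
    L2Y :=
  WithLp.toLp 2 fun j => toL2 (decayingState k (c j) (b j)) (memLp_decayingState hk (hc j) (b j))

lemma deltaPrime_decayingVector {k : ℝ} (hk : 0 < k) {c b : Fin 3 → ℝ} {lam : ℝ}
    (hc : ∀ j, 0 < c j) (hb : IsKinkShift c lam b)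
    (h0 : secular (∑ j, c j) (Real.cos (kinkProfile (c 0) (b 0) 0 / 2)) lam k = 0) :
    DeltaPrime c lam (decayingVector hk hc b)
      (WithLp.toLp 2 fun j => toL2 _ (memLp_deriv_decayingState hk (hc j) (b j)))
      (WithLp.toLp 2 fun j => toL2 _ (memLp_deriv_deriv_decayingState hk (hc j) (b j))) := by
  have hs := fun j => contDiff_decayingState k (c j) (b j)
  have hs' := fun j => (contDiff_infty_iff_deriv.mp (hs j)).2
  have hq : ∀ j, (c j : ℂ) * (deriv (decayingState k (c j) (b j)) 0 : ℝ) =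
      -(k ^ 2 + k * Real.cos (kinkProfile (c 0) (b 0) 0 / 2)
      + Real.cos (kinkProfile (c 0) (b 0) 0 / 2) ^ 2 - 1 : ℝ) := fun j => by
    rw [← Complex.ofReal_mul, mul_deriv_decayingState_zero k (hc j).ne',
      hb.continuous_vertex j 0, Complex.ofReal_neg]
  have m0 := fun j => memLp_decayingState hk (hc j) (b j)
  have m1 := fun j => memLp_deriv_decayingState hk (hc j) (b j)
  refine ⟨fun j => hasWeakDeriv_toL2 (hs j) (m0 j) (m1 j), fun j => hasWeakDeriv_toL2 (hs' j) (m1 j)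
      (memLp_deriv_deriv_decayingState hk (hc j) (b j)),
    fun j => (decayingState k (c j) (b j) 0 : ℝ),
    fun j => (deriv (decayingState k (c j) (b j)) 0 : ℝ),
    fun j => hasTrace_toL2 (hs j).continuous (m0 j),
    fun j => hasTrace_toL2 (hs' j).continuous (m1 j),
    (hq 0).trans (hq 1).symm, (hq 1).trans (hq 2).symm, ?_⟩
  rw [hq 0]
  simp_rw [decayingState_zero, fun j => hb.continuous_vertex j 0]
  rw [← Finset.sum_mul, ← Complex.ofReal_neg]
  norm_cast
  unfold secular at h0
  linear_combination h0

lemma decayingVector_mem_eigenspace {k : ℝ} (hk : 0 < k) {c b : Fin 3 → ℝ} {lam : ℝ}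
    (hc : ∀ j, 0 < c j) (hb : IsKinkShift c lam b)
    (h0 : secular (∑ j, c j) (Real.cos (kinkProfile (c 0) (b 0) 0 / 2)) lam k = 0) :
    (⟨decayingVector hk hc b, _, _, deltaPrime_decayingVector hk hc hb h0⟩ :
      (linearizedOp c b lam).domain) ∈ eigenspace (linearizedOp c b lam) (1 - k ^ 2) := by
  rw [mem_eigenspace_linearizedOp_iff hc _ (deltaPrime_decayingVector hk hc hb h0)]
  intro j
  filter_upwards [coeFn_toL2 _ (memLp_deriv_deriv_decayingState hk (hc j) (b j)),
    coeFn_toL2 _ (memLp_decayingState hk (hc j) (b j))] with x h1 h2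
  simp only [decayingVector]
  rw [h1, h2, deriv_deriv_decayingState, Complex.ofReal_mul, Complex.real_smul]

lemma decayingVector_ne_zero {k : ℝ} (hk : 1 < k) {c : Fin 3 → ℝ} (hc : ∀ j, 0 < c j)
    (b : Fin 3 → ℝ) : decayingVector (one_pos.trans hk) hc b ≠ 0 := by
  intro h
  have h0 : toL2 _ (memLp_decayingState (one_pos.trans hk) (hc 0) (b 0)) = 0 :=
    congrArg (fun w : L2Y => w 0) h
  have ht := hasTrace_toL2 (contDiff_decayingState k (c 0) (b 0)).continuous
    (memLp_decayingState (one_pos.trans hk) (hc 0) (b 0))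
  have := ht.eq_of_ae_eq (F := 0) continuous_zero (by
    rw [h0]
    exact Lp.coeFn_zero _ _ _)
  exact (decayingState_pos hk (c 0) (b 0) 0).ne' (Complex.ofReal_eq_zero.mp this)

/-- Every eigenvector for `1 - k²` is a multiple of the vector of decaying states. -/
lemma exists_eq_smul_decayingVector {k : ℝ} (hk : 1 < k) {c b : Fin 3 → ℝ} {lam : ℝ}
    (hc : ∀ j, 0 < c j) (hb : IsKinkShift c lam b)
    (hcos : 0 ≤ Real.cos (kinkProfile (c 0) (b 0) 0 / 2))
    {v : (linearizedOp c b lam).domain}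
    (hv : v ∈ eigenspace (linearizedOp c b lam) (1 - k ^ 2)) :
    ∃ a : ℂ, (v : L2Y) = a • decayingVector (one_pos.trans hk) hc b ∧
      a * secular (∑ j, c j) (Real.cos (kinkProfile (c 0) (b 0) 0 / 2)) lam k = 0 := by
  have hk0 : 0 < k := one_pos.trans hk
  obtain ⟨v', v'', hD⟩ := v.2
  rw [mem_eigenspace_linearizedOp_iff hc v hD] at hv
  obtain ⟨h1, h2, p, q, hp, hq, hq1, hq2, hpq⟩ := hD
  have hs := fun j => contDiff_decayingState k (c j) (b j)
  have hs' := fun j => (contDiff_infty_iff_deriv.mp (hs j)).2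
  choose a ha ha' using fun j => exists_ae_eq_smul_of_weak_solution (h1 j) (h2 j) (hs j)
    (decayingState_pos hk (c j) (b j)) (deriv_deriv_decayingState k (c j) (b j)) (hv j)
    (memLp_decayingState hk0 (hc j) (b j)) (memLp_deriv_decayingState hk0 (hc j) (b j))
  set t := Real.cos (kinkProfile (c 0) (b 0) 0 / 2) with ht
  have hpj : ∀ j, p j = a j * ((k + t : ℝ) : ℂ) := fun j => by
    have hcont : Continuous fun x => a j * (decayingState k (c j) (b j) x : ℂ) :=
      continuous_const.mul (Complex.continuous_ofReal.comp (hs j).continuous)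
    rw [(hp j).eq_of_ae_eq hcont (ha j), decayingState_zero, hb.continuous_vertex j 0]
  set D := k ^ 2 + k * t + t ^ 2 - 1 with hDdef
  have hqj : ∀ j, (c j : ℂ) * q j = a j * ((-D : ℝ) : ℂ) := fun j => by
    have hcont : Continuous fun x => a j * (deriv (decayingState k (c j) (b j)) x : ℝ) :=
      continuous_const.mul (Complex.continuous_ofReal.comp (hs' j).continuous)
    have e := mul_deriv_decayingState_zero k (hc j).ne' (b j)
    rw [hb.continuous_vertex j 0] at e
    rw [(hq j).eq_of_ae_eq hcont (ha' j), mul_left_comm, ← Complex.ofReal_mul, e]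
  -- Here `k > 1` and `t ≥ 0` enter: a nonzero flux factor lets the flux conditions identify the
  -- three coefficients.
  have hD0 : ((-D : ℝ) : ℂ) ≠ 0 := by
    rw [Complex.ofReal_ne_zero]
    have : 0 < D := by nlinarith [mul_nonneg hk0.le hcos]
    linarith
  have h01 : a 0 = a 1 := mul_right_cancel₀ hD0 (by rw [← hqj, ← hqj, hq1])
  have h12 : a 1 = a 2 := mul_right_cancel₀ hD0 (by rw [← hqj, ← hqj, hq2])
  have haj : ∀ j, a j = a 0 := by
    intro j
    fin_cases j
    · rfl
    · exact h01.symm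
    · exact (h01.trans h12).symm
  refine ⟨a 0, ?_, ?_⟩
  · ext1 j
    apply Lp.ext
    have e1 := coeFn_toL2 _ (memLp_decayingState hk0 (hc j) (b j))
    have e2 := Lp.coeFn_smul (a 0) (decayingVector hk0 hc b j)
    filter_upwards [ha j, e1, e2] with x x1 x2 x3
    have x3' : ((a 0 • decayingVector hk0 hc b) j : L2) x =
      a 0 * (toL2 _ (memLp_decayingState hk0 (hc j) (b j))) x := x3
    rw [x1, x3', x2, haj]
  · simp_rw [hpj, haj] at hpq
    rw [hqj 0, ← Finset.sum_mul] at hpq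
    unfold secular
    rw [← hDdef]
    push_cast at hpq ⊢
    linear_combination hpq

/-- Writing `f` as the cardinality of the propositions `j = i` turns the sum into the cardinality of
a one-point sigma type. -/
lemma _root_.Cardinal.sum_eq_one {ι : Type} (f : ι → Cardinal.{0}) (i : ι) (hi : f i = 1)
    (h : ∀ j, j ≠ i → f j = 0) : Cardinal.sum f = 1 := by
  have e : f = fun j => Cardinal.mk (PLift (j = i)) := by
    funext j
    by_cases hj : j = i
    · have : Unique (PLift (j = i)) := ⟨⟨⟨hj⟩⟩, fun _ => Subsingleton.elim _ _⟩
      rw [Cardinal.mk_eq_one, hj, hi]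
    · have : IsEmpty (PLift (j = i)) := ⟨fun x => hj x.down⟩
      rw [Cardinal.mk_eq_zero, h j hj]
  rw [e, ← Cardinal.mk_sigma, Cardinal.eq_one_iff_unique]
  exact ⟨⟨fun ⟨_, ⟨hx⟩⟩ ⟨_, ⟨hy⟩⟩ => by subst hx hy; rfl⟩, ⟨⟨i, ⟨rfl⟩⟩⟩⟩

end Tricrystal

end

open Tricrystal in
theorem proposition3p5 (c : Fin 3 → ℝ) (hc : ∀ j, 0 < c j) (lam : ℝ)
    (hlam : lam ∈ Set.Ico (-(Real.pi / 2) * ∑ j, c j) (-∑ j, c j))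
    (b : Fin 3 → ℝ) (hb : Tricrystal.IsKinkShift c lam b) :
    Tricrystal.morseIndex (Tricrystal.linearizedOp c b lam) = 1 := by
  have hS : 0 < ∑ j, c j := Finset.sum_pos (fun j _ => hc j) Finset.univ_nonempty
  have hlam0 : lam < 0 := hlam.2.trans (neg_neg_of_pos hS)
  have hθ' := half_kinkProfile_zero_le hc hlam.1 hb
  have hθ := half_pos (kinkProfile_pos (c 0) (b 0) 0)
  have hcos : 0 ≤ Real.cos (kinkProfile (c 0) (b 0) 0 / 2) :=
    Real.cos_nonneg_of_mem_Icc ⟨by linarith [Real.pi_pos], hθ'⟩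
  have h1 := secular_one_pos hS hθ hθ' (hb.vertex hc)
  obtain ⟨k, hk, hk0⟩ := exists_secular_root hlam0 h1
  have hmem := decayingVector_mem_eigenspace (one_pos.trans hk) hc hb hk0
  -- The single contributing index is `1 - k²`, with `k` the root of `secular`.
  refine Cardinal.sum_eq_one _ ⟨1 - k ^ 2, by rw [Set.mem_Iio]; nlinarith⟩ ?_ ?_
  · refine rank_eq_one ⟨_, hmem⟩ (fun h => decayingVector_ne_zero hk hc b ?_) ?_
    · exact congrArg (fun w => ((w : (linearizedOp c b lam).domain) : L2Y)) (congrArg Subtype.val h)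
    · rintro ⟨w, hw⟩
      obtain ⟨a, ha, -⟩ := exists_eq_smul_decayingVector hk hc hb hcos hw
      exact ⟨a, Subtype.ext (Subtype.ext ha.symm)⟩
  · rintro ⟨μ, hμ⟩ hne
    have hμ0 : μ < 0 := hμ
    -- Every `μ < 0` has the form `1 - l²` with `l > 1`, so an eigenvalue other than `1 - k²` would
    -- give a second root.
    obtain ⟨l, hl, rfl⟩ : ∃ l, 1 < l ∧ μ = 1 - l ^ 2 :=
      ⟨√(1 - μ), by rw [Real.lt_sqrt zero_le_one]; linarith,
        by rw [Real.sq_sqrt (by linarith)]; ring⟩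
    have hbot : eigenspace (linearizedOp c b lam) (1 - l ^ 2) = ⊥ := by
      rw [eq_bot_iff]
      intro w hw
      obtain ⟨a, ha, ha0⟩ := exists_eq_smul_decayingVector hl hc hb hcos hw
      rcases mul_eq_zero.mp ha0 with h | h
      · rw [h, zero_smul] at ha
        exact Subtype.ext ha
      · refine absurd ?_ hne
        have := secular_root_unique hlam0 h1 hl hk (Complex.ofReal_eq_zero.mp h) hk0
        exact Subtype.ext (congrArg (fun x => 1 - x ^ 2) this)
    change Module.rank ℂ (eigenspace (linearizedOp c b lam) (1 - l ^ 2)) = 0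
    rw [hbot, rank_bot]
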